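/- Let $f:\mathbb{R}\to\mathbb{R}$ be piecewise continuous (finitely many discontinuities in every bounded interval). Consider the system $$y_{t+1}=\theta f(y_t)+u_t+w_{t+1},\qquad t\ge 0,$$ with deterministic initial value $y_0\in\mathbb{R}$, where $w_1,w_2,\dots$ are i.i.d. random variables with law $N(0,1)$, and $\theta$ is a random variable with law $N(\theta_0,P_0)$, $\theta_0\in\mathbb{R}$, $P_0>0$, independent of $\{w_t\}$. A feedback control law prescribes, for each initial value $y_0$, real inputs $u_t$ such that $u_t$ is measurable with respect to $\sigma(y_0,\dots,y_t)$ for every $t\ge 0$. The system is called unstabilizable if for every feedback control law there exist an initial value $y_0\in\mathbb{R}$ and an event $D$ of positive probability such that $$\limsup_{t\to+\infty}\frac1t\sum_{i=1}^{t}y_i^2=+\infty\quad\text{on } D.$$ For $L>0$ let $S_4^L=\{x\in\mathbb{R}: |f(x)|<L|x|^4\}$, and let $\ell$ denote Lebesgue measure. Theorem. Suppose that there exist $\delta,L>0$ such that, as $l\to+\infty$, $$\sup_{x\in\mathbb{R}}\frac{\ell\left(S_4^L\cap[x-l,x+l]\right)}{l}=O\left(\frac{1}{(\log\log l)^{1+\delta}}\right).$$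 Then the system is unstabilizable. -/

import Mathlib

open MeasureTheory ProbabilityTheory Filter Set
open scoped NNReal

/-- `f : ℝ → ℝ` is piecewise continuous: every bounded interval contains only finitely many points
of discontinuity. (One-sided limits at these points are not required to exist.) -/
def PiecewiseContinuous (f : ℝ → ℝ) : Prop :=
  ∀ a b : ℝ, {x ∈ Icc a b | ¬ ContinuousAt f x}.Finite

/-- The set `S₄ᴸ = {x : |f x| < L |x| ^ 4}`. -/
def slowSet (f : ℝ → ℝ) (L : ℝ) : Set ℝ := {x | |f x| < L * |x| ^ 4}

/-- The σ-algebra `σ(y₀, …, y_t)` generated by the outputs up to time `t`. -/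
abbrev outputSigma {Ω : Type*} (y : ℕ → Ω → ℝ) (t : ℕ) : MeasurableSpace Ω :=
  ⨆ i ∈ Finset.Iic t, MeasurableSpace.comap (y i) inferInstance

/-- `y` and `u` are the output and input processes of the system
`y (t+1) = θ f (y t) + u t + w (t+1)`, started at the deterministic value `x₀`, under feedback:
the input `u t` is measurable with respect to `σ(y₀, …, y_t)`. -/
structure IsClosedLoop {Ω : Type*} (f : ℝ → ℝ) (θ : Ω → ℝ) (w : ℕ → Ω → ℝ) (x₀ : ℝ)
    (u y : ℕ → Ω → ℝ) : Prop where
  init : ∀ ω, y 0 ω = x₀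
  step : ∀ t ω, y (t + 1) ω = θ ω * f (y t ω) + u t ω + w (t + 1) ω
  feedback : ∀ t, Measurable[outputSigma y t] (u t)

/-- The system `y (t+1) = θ f (y t) + u t + w (t+1)` is unstabilizable: for every feedback control
law there are an initial value `x₀` and an event `D` of positive probability on which the averages
`(y₁² + ⋯ + y_t²) / t` have upper limit `+∞`. A law prescribes, for each initial value `x₀`, the
inputs `u x₀ 0, u x₀ 1, …`, and thereby the outputs `y x₀ 0, y x₀ 1, …`; every sequence of Borel
functions `g_t` of the history, `u_t = g_t (y₀, …, y_t)`, is of this form. -/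
def Unstabilizable {Ω : Type*} [MeasurableSpace Ω] (P : Measure Ω) (f : ℝ → ℝ) (θ : Ω → ℝ)
    (w : ℕ → Ω → ℝ) : Prop :=
  ∀ u y : ℝ → ℕ → Ω → ℝ, (∀ x₀, IsClosedLoop f θ w x₀ (u x₀) (y x₀)) →
    ∃ x₀ : ℝ, ∃ D : Set Ω, MeasurableSet D ∧ 0 < P D ∧ ∀ ω ∈ D,
      limsup (fun t : ℕ => (((1 / (t : ℝ)) * ∑ i ∈ Finset.Icc 1 t, (y x₀ i ω) ^ 2 : ℝ) : EReal))
        atTop = ⊤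

/-! Let `r t = 1/P₀ + ∑_{i<t} f(y i)²`. Given `y 0, …, y t`, the parameter `θ` is normal with
variance `1 / r t` (`IsClosedLoop.posterior`), so the next output is normal with variance `1 + f(y
t)² / r t = r (t+1) / r t` (`IsClosedLoop.predictive`). The input only moves the centre of this law;
every estimate below is uniform in the centre.

Two things can go wrong at time `t+1`: the output is small compared with its standard deviation, or
it falls into `slowSet f L`. Otherwise `f(y (t+1))² ≥ L² |y (t+1)|⁸` gives `r (t+2) ≥ L² (η 2⁻ᵗ)⁸ (r
(t+1) / r t)⁴`. For `a t = log (r t)` this reads `a (t+2) ≥ 4 (a (t+1) - a t) - O(t+1)`. The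
characteristic equation `x² = 4x - 4` has the double root 2: the exponent 4 is critical, and a large
enough `f(x₀)` forces `log (r (t+1) / r t) ≥ K 2ᵗ + 8t` (`log_ratio_ge_of_recursion`).

At a standard deviation that is doubly exponential in `t`, its iterated logarithm is at least of
order `t + N`. The density hypothesis then bounds the probability of hitting the slow set by a
multiple of `(t+N)^{-(1+δ)}` (`exists_gaussianReal_preimage_le`), which is summable. With `N` large
the bad events have total probability at most 1/2, and off them the outputs blow up. -/

/-! ### Gaussian conditioning for one linear observation. -/

/-- Invariance of the standard Gaussian measure on the plane under the rotation of slope `b`. -/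
lemma lintegral_gaussianReal_rotation (b : ℝ) {H : ℝ × ℝ → ENNReal} (hH : Measurable H) :
    ∫⁻ w, ∫⁻ n, H (w, n) ∂gaussianReal 0 1 ∂gaussianReal 0 1 =
      ∫⁻ p, ∫⁻ q, H ((p - b * q) / √(1 + b ^ 2), (b * p + q) / √(1 + b ^ 2))
        ∂gaussianReal 0 1 ∂gaussianReal 0 1 := by
  have h0 : (gaussianReal 0 1)[id] = 0 := by simp
  rw [← lintegral_prod _ hH.aemeasurable,
    ← IsGaussian.map_rotation_eq_self h0 (-(Real.arctan b)),
    lintegral_map hH (ContinuousLinearMap.measurable _), lintegral_prod]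
  · refine lintegral_congr fun p => lintegral_congr fun q => ?_
    rw [ContinuousLinearMap.rotation_apply]
    congr 2
    · simp only [Real.cos_neg, Real.sin_neg, Real.cos_arctan, Real.sin_arctan, smul_eq_mul]
      ring
    · simp only [Real.cos_neg, Real.sin_neg, Real.cos_arctan, Real.sin_arctan, smul_eq_mul]
      ring
  · exact (hH.comp (ContinuousLinearMap.measurable _)).aemeasurable

section Bayes

variable {Ω 𝓗 : Type*} [MeasurableSpace Ω] [MeasurableSpace 𝓗] {P : Measure Ω}
  [IsProbabilityMeasure P] {X : Ω → 𝓗} {θ W : Ω → ℝ} {a c m s : 𝓗 → ℝ}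

/-- If `θ` is conditionally `N(m X, (s X)²)` given `X`, and `W` is an independent standard Gaussian,
this is the joint law of `X`, the observation `θ * a X + c X + W` and `θ`. -/
lemma lintegral_gaussian_observation (hX : Measurable X) (hθ : Measurable θ) (hW : Measurable W)
    (hWlaw : P.map W = gaussianReal 0 1) (hind : IndepFun (fun ω => (X ω, θ ω)) W P)
    (ha : Measurable a) (hc : Measurable c)
    (hpost : ∀ F : 𝓗 × ℝ → ENNReal, Measurable F → ∫⁻ ω, F (X ω, θ ω) ∂P =
      ∫⁻ ω, ∫⁻ n, F (X ω, m (X ω) + s (X ω) * n) ∂gaussianReal 0 1 ∂P)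
    {G : 𝓗 × ℝ × ℝ → ENNReal} (hG : Measurable G) :
    ∫⁻ ω, G (X ω, θ ω * a (X ω) + c (X ω) + W ω, θ ω) ∂P =
      ∫⁻ ω, ∫⁻ p, ∫⁻ q, G (X ω, m (X ω) * a (X ω) + c (X ω) + √(1 + (s (X ω) * a (X ω)) ^ 2) * p,
        m (X ω) + s (X ω) * ((s (X ω) * a (X ω) * p + q) / √(1 + (s (X ω) * a (X ω)) ^ 2)))
        ∂gaussianReal 0 1 ∂gaussianReal 0 1 ∂P := by
  have h1 : ∫⁻ ω, G (X ω, θ ω * a (X ω) + c (X ω) + W ω, θ ω) ∂P =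
      ∫⁻ ω, ∫⁻ w, G (X ω, θ ω * a (X ω) + c (X ω) + w, θ ω) ∂gaussianReal 0 1 ∂P := by
    have hprod := (indepFun_iff_map_prod_eq_prod_map_map (hX.prodMk hθ).aemeasurable
      hW.aemeasurable).1 hind
    have hK : Measurable fun v : (𝓗 × ℝ) × ℝ => G (v.1.1, v.1.2 * a v.1.1 + c v.1.1 + v.2, v.1.2) := by
      fun_prop
    have e1 := lintegral_map (μ := P) hK ((hX.prodMk hθ).prodMk hW)
    rw [hprod, hWlaw, lintegral_prod _ hK.aemeasurable,
      lintegral_map hK.lintegral_prod_right' (hX.prodMk hθ)] at e1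
    exact e1.symm
  have hK : Measurable fun v : (𝓗 × ℝ) × ℝ => G (v.1.1, v.1.2 * a v.1.1 + c v.1.1 + v.2, v.1.2) := by
    fun_prop
  rw [h1, hpost (fun v => ∫⁻ w, G (v.1, v.2 * a v.1 + c v.1 + w, v.2) ∂gaussianReal 0 1)
    hK.lintegral_prod_right']
  refine lintegral_congr fun ω => ?_
  generalize X ω = h
  rw [lintegral_lintegral_swap]
  -- With slope `b = s a`, the rotation turns `b n + W` into `√(1 + b²) p`: `p` is the normalized
  -- innovation, and `q` is independent of it.
  · rw [lintegral_gaussianReal_rotation (s h * a h)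
      (H := fun v => G (h, (m h + s h * v.2) * a h + c h + v.1, m h + s h * v.2)) (by fun_prop)]
    refine lintegral_congr fun p => lintegral_congr fun q => ?_
    have hpos : 0 < 1 + (s h * a h) ^ 2 := by positivity
    have hne : √(1 + (s h * a h) ^ 2) ≠ 0 := (Real.sqrt_pos.2 hpos).ne'
    have hsq : √(1 + (s h * a h) ^ 2) ^ 2 = 1 + (s h * a h) ^ 2 := Real.sq_sqrt hpos.le
    congr 3
    generalize √(1 + (s h * a h) ^ 2) = ρ at *
    field_simp
    linear_combination (-p) * hsq
  · fun_prop

/-- The predictive law of the observation. -/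
lemma lintegral_gaussian_predictive (hX : Measurable X) (hθ : Measurable θ) (hW : Measurable W)
    (hWlaw : P.map W = gaussianReal 0 1) (hind : IndepFun (fun ω => (X ω, θ ω)) W P)
    (ha : Measurable a) (hc : Measurable c)
    (hpost : ∀ F : 𝓗 × ℝ → ENNReal, Measurable F → ∫⁻ ω, F (X ω, θ ω) ∂P =
      ∫⁻ ω, ∫⁻ n, F (X ω, m (X ω) + s (X ω) * n) ∂gaussianReal 0 1 ∂P)
    {F : 𝓗 × ℝ → ENNReal} (hF : Measurable F) :
    ∫⁻ ω, F (X ω, θ ω * a (X ω) + c (X ω) + W ω) ∂P =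
      ∫⁻ ω, ∫⁻ p, F (X ω, m (X ω) * a (X ω) + c (X ω) + √(1 + (s (X ω) * a (X ω)) ^ 2) * p)
        ∂gaussianReal 0 1 ∂P := by
  rw [lintegral_gaussian_observation hX hθ hW hWlaw hind ha hc hpost
    (G := fun v => F (v.1, v.2.1)) (by fun_prop)]
  simp

/-- The Bayes update of the conditional law of `θ`, given `X` and the observation. -/
lemma lintegral_gaussian_posterior (hX : Measurable X) (hθ : Measurable θ) (hW : Measurable W)
    (hWlaw : P.map W = gaussianReal 0 1) (hind : IndepFun (fun ω => (X ω, θ ω)) W P)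
    (ha : Measurable a) (hc : Measurable c) (hm : Measurable m) (hs : Measurable s)
    (hpost : ∀ F : 𝓗 × ℝ → ENNReal, Measurable F → ∫⁻ ω, F (X ω, θ ω) ∂P =
      ∫⁻ ω, ∫⁻ n, F (X ω, m (X ω) + s (X ω) * n) ∂gaussianReal 0 1 ∂P) :
    ∃ m' : 𝓗 × ℝ → ℝ, Measurable m' ∧ ∀ F : (𝓗 × ℝ) × ℝ → ENNReal, Measurable F →
      ∫⁻ ω, F ((X ω, θ ω * a (X ω) + c (X ω) + W ω), θ ω) ∂P =
        ∫⁻ ω, ∫⁻ n, F ((X ω, θ ω * a (X ω) + c (X ω) + W ω),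
          m' (X ω, θ ω * a (X ω) + c (X ω) + W ω) +
            s (X ω) / √(1 + (s (X ω) * a (X ω)) ^ 2) * n) ∂gaussianReal 0 1 ∂P := by
  -- The Kalman update: the coefficient of `p` in `θ`, with `p` expressed through the observation
  -- `v.2`.
  let m' : 𝓗 × ℝ → ℝ := fun v => m v.1 + s v.1 * (s v.1 * a v.1 *
    (v.2 - m v.1 * a v.1 - c v.1)) / (1 + (s v.1 * a v.1) ^ 2)
  have hm' : Measurable m' := by fun_prop
  refine ⟨m', hm', fun F hF => ?_⟩
  have hK : Measurable fun v : (𝓗 × ℝ × ℝ) × ℝ => F ((v.1.1, v.1.2.1), m' (v.1.1, v.1.2.1) +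
      s v.1.1 / √(1 + (s v.1.1 * a v.1.1) ^ 2) * v.2) := by fun_prop
  rw [lintegral_gaussian_observation hX hθ hW hWlaw hind ha hc hpost
    (G := fun v => F ((v.1, v.2.1), v.2.2)) (by fun_prop),
    lintegral_gaussian_observation hX hθ hW hWlaw hind ha hc hpost
    (G := fun v => ∫⁻ n, F ((v.1, v.2.1), m' (v.1, v.2.1) +
      s v.1 / √(1 + (s v.1 * a v.1) ^ 2) * n) ∂gaussianReal 0 1) hK.lintegral_prod_right']
  simp only [lintegral_const, measure_univ, mul_one]
  refine lintegral_congr fun ω => lintegral_congr fun p => lintegral_congr fun q => ?_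
  generalize X ω = h
  have hpos : 0 < 1 + (s h * a h) ^ 2 := by positivity
  have hne : √(1 + (s h * a h) ^ 2) ≠ 0 := (Real.sqrt_pos.2 hpos).ne'
  have hsq : √(1 + (s h * a h) ^ 2) ^ 2 = 1 + (s h * a h) ^ 2 := Real.sq_sqrt hpos.le
  congr 2
  simp only [m']
  generalize √(1 + (s h * a h) ^ 2) = ρ at *
  rw [← hsq]
  field_simp
  ring

end Bayes

/-! ### Measurability and independence. -/

lemma PiecewiseContinuous.measurable {f : ℝ → ℝ} (hf : PiecewiseContinuous f) : Measurable f := by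
  have hcount : {x | ¬ ContinuousAt f x}.Countable := by
    have : {x | ¬ ContinuousAt f x} = ⋃ n : ℕ, {x ∈ Icc (-(n : ℝ)) n | ¬ ContinuousAt f x} := by
      ext x
      simp only [mem_ofPred_eq, mem_iUnion, mem_Icc]
      constructor
      · intro hx
        obtain ⟨n, hn⟩ := exists_nat_ge |x|
        exact ⟨n, abs_le.1 hn, hx⟩
      · rintro ⟨n, -, hx⟩
        exact hx
    rw [this]
    exact countable_iUnion fun n => (hf _ _).countable
  have hcompl : Measurable (({x | ¬ ContinuousAt f x}ᶜ).domRestrict f) := by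
    refine (continuousOn_iff_continuous_domRestrict.1 fun x hx => ?_).measurable
    have : ContinuousAt f x := not_not.1 hx
    exact this.continuousWithinAt
  have := hcount.to_subtype
  exact measurable_of_restrict_of_restrict_compl hcount.measurableSet
    (measurable_of_countable _) hcompl

lemma measurableSet_slowSet {f : ℝ → ℝ} (hf : Measurable f) (L : ℝ) :
    MeasurableSet (slowSet f L) :=
  measurableSet_lt (by fun_prop) (by fun_prop)

/-- If `V` and `W` are independent, and `A` is independent of `(V, W)`, then `(A, V)` and `W` are
independent. -/
lemma ProbabilityTheory.IndepFun.prodMk_left {Ω α β γ : Type*} [MeasurableSpace Ω]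
    [MeasurableSpace α] [MeasurableSpace β] [MeasurableSpace γ] {P : Measure Ω}
    [IsProbabilityMeasure P] {A : Ω → α} {V : Ω → β} {W : Ω → γ} (hA : Measurable A)
    (hV : Measurable V) (hW : Measurable W) (hVW : IndepFun V W P)
    (hAVW : IndepFun A (fun ω => (V ω, W ω)) P) : IndepFun (fun ω => (A ω, V ω)) W P := by
  have hAV : IndepFun A V P := hAVW.comp measurable_id measurable_fst
  have e1 := (indepFun_iff_map_prod_eq_prod_map_map hA.aemeasurable
    (hV.prodMk hW).aemeasurable).1 hAVW
  have e2 := (indepFun_iff_map_prod_eq_prod_map_map hV.aemeasurable hW.aemeasurable).1 hVW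
  have e3 := (indepFun_iff_map_prod_eq_prod_map_map hA.aemeasurable hV.aemeasurable).1 hAV
  rw [indepFun_iff_map_prod_eq_prod_map_map (hA.prodMk hV).aemeasurable hW.aemeasurable, e3]
  have := Measure.isProbabilityMeasure_map (μ := P) hA.aemeasurable
  have := Measure.isProbabilityMeasure_map (μ := P) hV.aemeasurable
  have := Measure.isProbabilityMeasure_map (μ := P) hW.aemeasurable
  rw [e2, ← Measure.prodAssoc_prod] at e1
  have e4 := congrArg (Measure.map MeasurableEquiv.prodAssoc.symm) e1
  rw [MeasurableEquiv.map_symm_map, Measure.map_map (MeasurableEquiv.measurable _)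
    (hA.prodMk (hV.prodMk hW))] at e4
  exact e4

/-! ### Posterior and predictive laws in closed loop. -/

section ClosedLoop

variable {Ω : Type*} {f : ℝ → ℝ} {θ : Ω → ℝ} {w : ℕ → Ω → ℝ} {x₀ : ℝ} {u y : ℕ → Ω → ℝ}

/-- The outputs up to time `t`, extended by `0`. -/
def history (y : ℕ → Ω → ℝ) (t : ℕ) (ω : Ω) (i : ℕ) : ℝ := if i ≤ t then y i ω else 0

lemma history_of_le {i t : ℕ} (h : i ≤ t) (ω : Ω) : history y t ω i = y i ω := if_pos h

lemma history_succ (t : ℕ) (ω : Ω) :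
    history y (t + 1) ω = Function.update (history y t ω) (t + 1) (y (t + 1) ω) := by
  ext i
  rcases lt_trichotomy i (t + 1) with h | rfl | h
  · rw [Function.update_of_ne h.ne, history_of_le h.le, history_of_le (Nat.lt_succ_iff.1 h)]
  · simp [history]
  · rw [Function.update_of_ne h.ne']
    simp [history, show ¬ i ≤ t + 1 by omega, show ¬ i ≤ t by omega]

/-- Erasing the last entry recovers the earlier history, so the pair (history, new output) can be
traded for the next history within one fixed type. -/
lemma update_history_succ (t : ℕ) (ω : Ω) :
    Function.update (history y (t + 1) ω) (t + 1) 0 = history y t ω := by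
  rw [history_succ, Function.update_idem, Function.update_eq_self_iff]
  simp [history]

lemma measurable_history {mΩ : MeasurableSpace Ω} {t : ℕ} (hy : ∀ i ≤ t, Measurable (y i)) :
    Measurable (history y t) := by
  refine measurable_pi_lambda _ fun i => ?_
  by_cases h : i ≤ t
  · simpa only [history, if_pos h] using hy i h
  · simpa only [history, if_neg h] using measurable_const

/-- Doob–Dynkin factorization. -/
lemma IsClosedLoop.exists_input_eq (hcl : IsClosedLoop f θ w x₀ u y) (t : ℕ) :
    ∃ g : (ℕ → ℝ) → ℝ, Measurable g ∧ ∀ ω, u t ω = g (history y t ω) := by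
  have hle : outputSigma y t ≤ MeasurableSpace.comap (history y t) inferInstance := by
    refine iSup₂_le fun i hi => ?_
    have hi' : i ≤ t := Finset.mem_Iic.1 hi
    have : y i = (fun h : ℕ → ℝ => h i) ∘ history y t := by
      ext ω
      exact (history_of_le hi' ω).symm
    rw [this, ← MeasurableSpace.comap_comp]
    exact MeasurableSpace.comap_mono (measurable_pi_apply i).comap_le
  have hu : Measurable[MeasurableSpace.comap (history y t) inferInstance] (u t) :=
    (hcl.feedback t).mono hle le_rfl
  obtain ⟨g, hg, hgu⟩ := hu.exists_eq_measurable_comp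
  exact ⟨g, hg, fun ω => congrFun hgu ω⟩

/-- The σ-algebra is arbitrary because the lemma serves both for the ambient one and for the one
generated by `θ` and the noise before time `t + 1`. -/
lemma IsClosedLoop.measurable_output {𝒢 : MeasurableSpace Ω} (hcl : IsClosedLoop f θ w x₀ u y)
    (hf : Measurable f) {t : ℕ} (hθ : Measurable θ) (hw : ∀ i < t, Measurable (w (i + 1))) :
    ∀ i ≤ t, Measurable (y i) := by
  intro i
  induction i using Nat.strong_induction_on with
  | _ i ih =>
    intro hi
    rcases i with _ | i
    · have : y 0 = fun _ => x₀ := funext hcl.init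
      rw [this]
      exact measurable_const
    · have hle : outputSigma y i ≤ 𝒢 := iSup₂_le fun j hj =>
        (ih j (by have := Finset.mem_Iic.1 hj; omega)
          (by have := Finset.mem_Iic.1 hj; omega)).comap_le
      have hu : Measurable (u i) := (hcl.feedback i).mono hle le_rfl
      have : y (i + 1) = fun ω => θ ω * f (y i ω) + u i ω + w (i + 1) ω := funext (hcl.step i)
      rw [this]
      exact ((hθ.mul (hf.comp (ih i (by omega) (by omega)))).add hu).add (hw i (by omega))

/-- Outputs up to time `t` are functions of `θ` and `w 1, …, w t` alone, and these are jointly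
independent of `w (t+1)`. -/
lemma IsClosedLoop.indepFun_noise [MeasurableSpace Ω] {P : Measure Ω} [IsProbabilityMeasure P]
    (hcl : IsClosedLoop f θ w x₀ u y) (hf : Measurable f) (hθ : Measurable θ)
    (hw : ∀ t, Measurable (w (t + 1))) (hw_indep : iIndepFun (fun t : ℕ => w (t + 1)) P)
    (hθ_indep : IndepFun θ (fun ω (t : ℕ) => w (t + 1) ω) P) (t : ℕ) :
    IndepFun (fun ω => (history y t ω, θ ω)) (w (t + 1)) P := by
  let V : Ω → (Finset.range t → ℝ) := fun ω i => w (i + 1) ω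
  have hV : Measurable V := measurable_pi_lambda _ fun i => hw _
  have hVw : IndepFun V (w (t + 1)) P := by
    have h := hw_indep.indepFun_finset (Finset.range t) {t} (by simp) hw
    exact h.comp (φ := id) (ψ := fun v : ({t} : Finset ℕ) → ℝ => v ⟨t, by simp⟩)
      measurable_id (measurable_pi_apply _)
  have hθVw : IndepFun θ (fun ω => (V ω, w (t + 1) ω)) P :=
    hθ_indep.comp (φ := id)
      (ψ := fun v : ℕ → ℝ => ((fun i : Finset.range t => v i), v t)) measurable_id (by fun_prop)
  have hind := hVw.prodMk_left hθ hV (hw t) hθVw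
  have hθV : Measurable[MeasurableSpace.comap (fun ω => (θ ω, V ω)) inferInstance]
      (fun ω => (θ ω, V ω)) := comap_measurable _
  have hθ' : Measurable[MeasurableSpace.comap (fun ω => (θ ω, V ω)) inferInstance] θ :=
    measurable_fst.comp hθV
  have hw' : ∀ i < t,
      Measurable[MeasurableSpace.comap (fun ω => (θ ω, V ω)) inferInstance] (w (i + 1)) :=
    fun i hi => ((measurable_pi_apply (⟨i, Finset.mem_range.2 hi⟩ : Finset.range t)).comp
      measurable_snd).comp hθV
  have hy := hcl.measurable_output hf hθ' hw'
  refine indep_of_indep_of_le_left hind (Measurable.comap_le ?_)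
  exact (measurable_history hy).prodMk hθ'

/-- The inverse of the conditional variance of the parameter given the outputs up to time `t`. -/
noncomputable def precision (f : ℝ → ℝ) (P₀ : ℝ≥0) (t : ℕ) (h : ℕ → ℝ) : ℝ :=
  1 / P₀ + ∑ i ∈ Finset.range t, f (h i) ^ 2

variable {P₀ : ℝ≥0}

lemma precision_pos (hP₀ : 0 < P₀) (t : ℕ) (h : ℕ → ℝ) : 0 < precision f P₀ t h := by
  have : (0 : ℝ) < 1 / P₀ := by positivity
  exact add_pos_of_pos_of_nonneg this (Finset.sum_nonneg fun i _ => sq_nonneg _)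

lemma precision_succ (t : ℕ) (h : ℕ → ℝ) :
    precision f P₀ (t + 1) h = precision f P₀ t h + f (h t) ^ 2 := by
  simp [precision, Finset.sum_range_succ, add_assoc]

lemma precision_congr {t : ℕ} {h h' : ℕ → ℝ} (H : ∀ i < t, h i = h' i) :
    precision f P₀ t h = precision f P₀ t h' := by
  unfold precision
  congr 1
  exact Finset.sum_congr rfl fun i hi => by rw [H i (Finset.mem_range.1 hi)]

lemma measurable_precision (hf : Measurable f) (t : ℕ) : Measurable (precision f P₀ t) := by
  unfold precision
  fun_prop

lemma one_add_sq_inv_sqrt_precision_mul (hP₀ : 0 < P₀) (t : ℕ) (h : ℕ → ℝ) :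
    1 + ((√(precision f P₀ t h))⁻¹ * f (h t)) ^ 2 =
      precision f P₀ (t + 1) h / precision f P₀ t h := by
  have hr := precision_pos (f := f) hP₀ t h
  rw [precision_succ, mul_pow, inv_pow, Real.sq_sqrt hr.le]
  field_simp

/-- Given the outputs up to time `t`, the parameter is normal, and its variance does not depend on
the control law. -/
lemma IsClosedLoop.posterior [MeasurableSpace Ω] {P : Measure Ω} [IsProbabilityMeasure P]
    (hcl : IsClosedLoop f θ w x₀ u y) (hf : Measurable f) (hθ : Measurable θ)
    (hw : ∀ t, Measurable (w (t + 1))) (hw_law : ∀ t : ℕ, P.map (w (t + 1)) = gaussianReal 0 1)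
    (hw_indep : iIndepFun (fun t : ℕ => w (t + 1)) P)
    (hθ_indep : IndepFun θ (fun ω (t : ℕ) => w (t + 1) ω) P) (hP₀ : 0 < P₀) {θ₀ : ℝ}
    (hθ_law : P.map θ = gaussianReal θ₀ P₀) (t : ℕ) :
    ∃ m : (ℕ → ℝ) → ℝ, Measurable m ∧ ∀ F : (ℕ → ℝ) × ℝ → ENNReal, Measurable F →
      ∫⁻ ω, F (history y t ω, θ ω) ∂P = ∫⁻ ω, ∫⁻ n, F (history y t ω, m (history y t ω) +
        (√(precision f P₀ t (history y t ω)))⁻¹ * n) ∂gaussianReal 0 1 ∂P := by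
  have hy : ∀ i, Measurable (y i) := fun i => hcl.measurable_output hf hθ (fun j _ => hw j) i le_rfl
  induction t with
  | zero =>
    refine ⟨fun _ => θ₀, measurable_const, fun F hF => ?_⟩
    have h0 : ∀ ω, history y 0 ω = fun i => if i = 0 then x₀ else 0 := by
      intro ω
      ext i
      by_cases hi : i = 0
      · simp [history, hi, hcl.init]
      · simp [history, hi]
    have hlaw : (gaussianReal 0 1).map (fun n => θ₀ + √P₀ * n) = gaussianReal θ₀ P₀ := by
      have e1 : (fun n => θ₀ + √(P₀ : ℝ) * n) = (fun x => θ₀ + x) ∘ fun n => √(P₀ : ℝ) * n := rfl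
      rw [e1, ← Measure.map_map (by fun_prop) (by fun_prop), gaussianReal_map_const_mul,
        gaussianReal_map_const_add]
      congr 1
      · simp
      · ext
        simp
    simp only [h0, precision, Finset.range_zero, Finset.sum_empty, add_zero, lintegral_const,
      measure_univ, mul_one, one_div, Real.sqrt_inv, inv_inv]
    have hF' : Measurable fun x => F ((fun i => if i = 0 then x₀ else 0), x) := by fun_prop
    rw [← lintegral_map hF' hθ, hθ_law, ← hlaw, lintegral_map hF' (by fun_prop)]
  | succ t ih =>
    obtain ⟨m, hm, hpost⟩ := ih
    obtain ⟨g, hg, hgu⟩ := hcl.exists_input_eq t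
    have hX : Measurable (history y t) := measurable_history fun i _ => hy i
    obtain ⟨m', hm', hpost'⟩ := lintegral_gaussian_posterior (a := fun h => f (h t)) (c := g)
      (s := fun h => (√(precision f P₀ t h))⁻¹) hX hθ (hw t) (hw_law t)
      (hcl.indepFun_noise hf hθ hw hw_indep hθ_indep t) (by fun_prop) hg hm
      (measurable_precision hf t).sqrt.inv hpost
    refine ⟨fun h => m' (Function.update h (t + 1) 0, h (t + 1)), by fun_prop, fun F hF => ?_⟩
    have hF' : Measurable fun v : ((ℕ → ℝ) × ℝ) × ℝ => F (Function.update v.1.1 (t + 1) v.1.2, v.2) :=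
      hF.comp ((measurable_update'.comp measurable_fst).prodMk measurable_snd)
    have hz : ∀ ω, θ ω * f (history y t ω t) + g (history y t ω) + w (t + 1) ω = y (t + 1) ω := by
      intro ω
      rw [hcl.step, hgu, history_of_le le_rfl]
    have key := hpost' _ hF'
    simp only [hz, ← history_succ] at key
    rw [key]
    refine lintegral_congr fun ω => lintegral_congr fun n => ?_
    beta_reduce
    rw [update_history_succ, history_of_le (le_refl (t + 1))]
    congr 4
    rw [one_add_sq_inv_sqrt_precision_mul hP₀]
    have hr := precision_pos (f := f) hP₀ t (history y t ω)
    have hr' := precision_pos (f := f) hP₀ (t + 1) (history y t ω)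
    rw [precision_congr (h := history y (t + 1) ω) (h' := history y t ω) (t := t + 1),
      Real.sqrt_div hr'.le]
    · have := (Real.sqrt_pos.2 hr).ne'
      field_simp
    · intro i hi
      rw [history_of_le hi.le, history_of_le (Nat.lt_succ_iff.1 hi)]

/-- Given the outputs up to time `t`, the next output is normal, and its variance does not depend on
the control law. -/
lemma IsClosedLoop.predictive [MeasurableSpace Ω] {P : Measure Ω} [IsProbabilityMeasure P]
    (hcl : IsClosedLoop f θ w x₀ u y) (hf : Measurable f) (hθ : Measurable θ)
    (hw : ∀ t, Measurable (w (t + 1))) (hw_law : ∀ t : ℕ, P.map (w (t + 1)) = gaussianReal 0 1)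
    (hw_indep : iIndepFun (fun t : ℕ => w (t + 1)) P)
    (hθ_indep : IndepFun θ (fun ω (t : ℕ) => w (t + 1) ω) P) (hP₀ : 0 < P₀) {θ₀ : ℝ}
    (hθ_law : P.map θ = gaussianReal θ₀ P₀) (t : ℕ) :
    ∃ c : (ℕ → ℝ) → ℝ, Measurable c ∧ ∀ F : (ℕ → ℝ) × ℝ → ENNReal, Measurable F →
      ∫⁻ ω, F (history y t ω, y (t + 1) ω) ∂P = ∫⁻ ω, ∫⁻ n, F (history y t ω, c (history y t ω) +
        √(precision f P₀ (t + 1) (history y t ω) / precision f P₀ t (history y t ω)) * n)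
          ∂gaussianReal 0 1 ∂P := by
  have hy : ∀ i, Measurable (y i) := fun i => hcl.measurable_output hf hθ (fun j _ => hw j) i le_rfl
  obtain ⟨m, hm, hpost⟩ := hcl.posterior hf hθ hw hw_law hw_indep hθ_indep hP₀ hθ_law t
  obtain ⟨g, hg, hgu⟩ := hcl.exists_input_eq t
  have hX : Measurable (history y t) := measurable_history fun i _ => hy i
  refine ⟨fun h => m h * f (h t) + g h, by fun_prop, fun F hF => ?_⟩
  have key := lintegral_gaussian_predictive (a := fun h => f (h t)) (c := g)
      (s := fun h => (√(precision f P₀ t h))⁻¹) hX hθ (hw t) (hw_law t)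
      (hcl.indepFun_noise hf hθ hw hw_indep hθ_indep t) (by fun_prop) hg hpost hF
  have hz : ∀ ω, θ ω * f (history y t ω t) + g (history y t ω) + w (t + 1) ω = y (t + 1) ω := by
    intro ω
    rw [hcl.step, hgu, history_of_le le_rfl]
  simpa only [hz, one_add_sq_inv_sqrt_precision_mul hP₀] using key

end ClosedLoop

/-! ### Gaussian estimates uniform in the centre. -/

lemma gaussianPDF_zero_one_le (x : ℝ) : gaussianPDF 0 1 x ≤ ENNReal.ofReal (Real.exp (-x ^ 2 / 2)) := by
  rw [gaussianPDF]
  refine ENNReal.ofReal_le_ofReal ?_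
  rw [gaussianPDFReal]
  have h1 : (√(2 * Real.pi * ((1 : ℝ≥0) : ℝ)))⁻¹ ≤ 1 := by
    refine inv_le_one_of_one_le₀ (Real.one_le_sqrt.2 ?_)
    have := Real.pi_gt_three
    simp only [NNReal.coe_one, mul_one]
    linarith
  have h2 : -(x - 0) ^ 2 / (2 * ((1 : ℝ≥0) : ℝ)) = -x ^ 2 / 2 := by simp
  rw [h2]
  exact mul_le_of_le_one_left (Real.exp_pos _).le h1

lemma gaussianReal_zero_one_le_volume (A : Set ℝ) : gaussianReal 0 1 A ≤ volume A := by
  rw [gaussianReal_apply _ one_ne_zero]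
  calc ∫⁻ x in A, gaussianPDF 0 1 x ≤ ∫⁻ _ in A, 1 := by
        refine lintegral_mono fun x => (gaussianPDF_zero_one_le x).trans ?_
        rw [← ENNReal.ofReal_one]
        refine ENNReal.ofReal_le_ofReal (Real.exp_le_one_iff.2 ?_)
        have := sq_nonneg x
        linarith
    _ = volume A := by simp

lemma gaussianReal_small_ball_le (c : ℝ) {ρ : ℝ} (hρ : 0 < ρ) (ε : ℝ) :
    gaussianReal 0 1 {n | |c + ρ * n| < ε * ρ} ≤ ENNReal.ofReal (2 * ε) := by
  refine (gaussianReal_zero_one_le_volume _).trans ?_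
  have : {n | |c + ρ * n| < ε * ρ} ⊆ Ioo (-(c / ρ) - ε) (-(c / ρ) + ε) := by
    intro n hn
    have hn' : |c + ρ * n| < ε * ρ := hn
    have e : c + ρ * n = (c / ρ + n) * ρ := by field_simp
    rw [e, abs_mul, abs_of_pos hρ, mul_lt_mul_iff_left₀ hρ, abs_lt] at hn'
    constructor <;> linarith [hn'.1, hn'.2]
  refine (measure_mono this).trans ?_
  rw [Real.volume_Ioo]
  refine ENNReal.ofReal_le_ofReal ?_
  linarith

lemma volume_preimage_affine_inter_le {S : Set ℝ} (c : ℝ) {ρ : ℝ} (hρ : 0 < ρ) (k : ℝ) :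
    volume ({n | c + ρ * n ∈ S} ∩ Icc (-k) k) =
      ENNReal.ofReal ρ⁻¹ * volume (S ∩ Icc (c - ρ * k) (c + ρ * k)) := by
  have e : {n | c + ρ * n ∈ S} ∩ Icc (-k) k =
      (fun n => ρ * n) ⁻¹' ((fun x => c + x) ⁻¹' (S ∩ Icc (c - ρ * k) (c + ρ * k))) := by
    ext n
    simp only [mem_inter_iff, mem_ofPred_eq, mem_Icc, mem_preimage]
    refine and_congr_right fun _ => and_congr ?_ ?_
    · constructor
      · intro h
        nlinarith
      · intro h
        nlinarith
    · constructor
      · intro h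
        nlinarith
      · intro h
        nlinarith
  rw [e, Real.volume_preimage_mul_left hρ.ne', measure_preimage_add, abs_of_pos (inv_pos.2 hρ)]

/-- A set with relative density at most `B` in all intervals of radius at least `ρ` has small
measure under all normal laws of standard deviation `ρ`. -/
lemma exists_gaussianReal_preimage_le : ∃ K : ℝ, 0 < K ∧ ∀ (S : Set ℝ), MeasurableSet S →
    ∀ (c ρ B : ℝ), 0 < ρ → 0 ≤ B →
    (∀ l ≥ ρ, ∀ x, volume (S ∩ Icc (x - l) (x + l)) ≤ ENNReal.ofReal (B * l)) →
    gaussianReal 0 1 {n | c + ρ * n ∈ S} ≤ ENNReal.ofReal (K * B) := by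
  -- Since `(|n| - 2)² ≥ 0`, `exp (-n²/2) ≤ exp (2 - 2|n|)`, which is at most `r k` for `k = ⌊|n|⌋`.
  -- The normal density is thus dominated by a summable mixture of indicators of intervals.
  let r : ℕ → ℝ := fun k => Real.exp 2 * Real.exp (-2) ^ k
  have hr : ∀ k, 0 ≤ r k := fun k => by positivity
  have hsum : Summable fun k : ℕ => r k * (k + 1) := by
    have h1 : ‖Real.exp (-2)‖ < 1 := by
      rw [Real.norm_eq_abs, abs_of_pos (Real.exp_pos _), Real.exp_lt_one_iff]
      norm_num
    have h2 := (summable_pow_mul_geometric_of_norm_lt_one 1 h1).add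
      (summable_geometric_of_norm_lt_one h1)
    refine (h2.mul_left (Real.exp 2)).congr fun k => ?_
    simp only [r]
    ring
  have hpos : 0 < ∑' k : ℕ, r k * (k + 1) :=
    hsum.tsum_pos (fun k => mul_nonneg (hr k) (by positivity)) 0 (by simp [r, Real.exp_pos])
  refine ⟨_, hpos, fun S hS c ρ B hρ hB hdens => ?_⟩
  set A : Set ℝ := {n | c + ρ * n ∈ S} with hA
  have hAm : MeasurableSet A := by
    have : Measurable fun n : ℝ => c + ρ * n := by fun_prop
    exact this hS
  have hpdf : ∀ n : ℝ, gaussianPDF 0 1 n ≤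
      ∑' k : ℕ, (Icc (-((k : ℝ) + 1)) (k + 1)).indicator (fun _ => ENNReal.ofReal (r k)) n := by
    intro n
    refine le_trans ?_ (ENNReal.le_tsum ⌊|n|⌋₊)
    have h1 : (⌊|n|⌋₊ : ℝ) ≤ |n| := Nat.floor_le (abs_nonneg n)
    have h2 : |n| < ⌊|n|⌋₊ + 1 := Nat.lt_floor_add_one _
    rw [indicator_of_mem (show n ∈ Icc (-((⌊|n|⌋₊ : ℝ) + 1)) (⌊|n|⌋₊ + 1) from abs_le.1 h2.le)]
    refine (gaussianPDF_zero_one_le n).trans (ENNReal.ofReal_le_ofReal ?_)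
    simp only [r]
    rw [← Real.exp_nat_mul, ← Real.exp_add]
    refine Real.exp_le_exp.2 ?_
    nlinarith [sq_nonneg (|n| - 2), sq_abs n]
  calc gaussianReal 0 1 A = ∫⁻ n in A, gaussianPDF 0 1 n := gaussianReal_apply _ one_ne_zero _
    _ ≤ ∫⁻ n in A, ∑' k : ℕ,
        (Icc (-((k : ℝ) + 1)) (k + 1)).indicator (fun _ => ENNReal.ofReal (r k)) n :=
        lintegral_mono hpdf
    _ = ∑' k : ℕ, ENNReal.ofReal (r k) * volume (A ∩ Icc (-((k : ℝ) + 1)) (k + 1)) := by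
        rw [lintegral_tsum fun k => (measurable_const.indicator measurableSet_Icc).aemeasurable]
        refine tsum_congr fun k => ?_
        rw [lintegral_indicator measurableSet_Icc, setLIntegral_const,
          Measure.restrict_apply measurableSet_Icc, inter_comm]
    _ ≤ ∑' k : ℕ, ENNReal.ofReal (r k * (k + 1) * B) := by
        refine ENNReal.tsum_le_tsum fun k => ?_
        rw [volume_preimage_affine_inter_le c hρ]
        have hk : ρ ≤ ρ * ((k : ℝ) + 1) := le_mul_of_one_le_right hρ.le (by simp)
        refine (mul_le_mul_right (mul_le_mul_right (hdens _ hk c) _) _).trans ?_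
        rw [← ENNReal.ofReal_mul (by positivity), ← ENNReal.ofReal_mul (hr k)]
        refine ENNReal.ofReal_le_ofReal (le_of_eq ?_)
        field_simp
    _ = ENNReal.ofReal ((∑' k : ℕ, r k * (k + 1)) * B) := by
        rw [← tsum_mul_right, ENNReal.ofReal_tsum_of_nonneg _ (hsum.mul_right B)]
        exact fun k => mul_nonneg (mul_nonneg (hr k) (by positivity)) hB

/-- One-step bound for a process whose next value is conditionally normal. -/
lemma measure_bad_le {Ω 𝓗 : Type*} [MeasurableSpace Ω] [MeasurableSpace 𝓗] {P : Measure Ω}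
    [IsProbabilityMeasure P] {X : Ω → 𝓗} {Z : Ω → ℝ} {c σ : 𝓗 → ℝ}
    (hpred : ∀ F : 𝓗 × ℝ → ENNReal, Measurable F → ∫⁻ ω, F (X ω, Z ω) ∂P =
      ∫⁻ ω, ∫⁻ n, F (X ω, c (X ω) + σ (X ω) * n) ∂gaussianReal 0 1 ∂P)
    (hX : Measurable X) (hZ : Measurable Z) {E : Set (𝓗 × ℝ)} (hE : MeasurableSet E) {p : ENNReal}
    (hp : ∀ h, gaussianReal 0 1 {n | (h, c h + σ h * n) ∈ E} ≤ p) :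
    P {ω | (X ω, Z ω) ∈ E} ≤ p := by
  have h1 : P {ω | (X ω, Z ω) ∈ E} = ∫⁻ ω, E.indicator 1 (X ω, Z ω) ∂P :=
    (lintegral_indicator_one (μ := P) ((hX.prodMk hZ) hE)).symm
  rw [h1, hpred _ (measurable_one.indicator hE)]
  calc _ ≤ ∫⁻ _, p ∂P := by
        refine lintegral_mono fun ω => ?_
        refine le_trans ?_ (hp (X ω))
        exact lintegral_indicator_one_le (μ := gaussianReal 0 1) {n | (X ω, c (X ω) + σ (X ω) * n) ∈ E}
    _ = p := by simp

/-! ### Growth of the precision. -/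

/-- The doubly exponential growth forced by the critical recursion
`r (t + 2) ≳ (r (t + 1) / r t) ^ 4`. -/
lemma log_ratio_ge_of_recursion {r : ℕ → ℝ} {L η K β : ℝ} (hr : ∀ t, 0 < r t)
    (hmono : ∀ t, r t ≤ r (t + 1)) (hL : 0 < L) (hη : 0 < η)
    (hβ : 8 - 2 * Real.log L - 8 * Real.log η ≤ β) (hβ0 : -Real.log (r 0) ≤ β)
    (hinit : K + β ≤ Real.log (r 1) - 2 * Real.log (r 0))
    (hrec : ∀ t : ℕ, K * 2 ^ t + 8 * t ≤ Real.log (r (t + 1) / r t) →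
      L ^ 2 * (η * (1 / 2) ^ t) ^ 8 * (r (t + 1) / r t) ^ 4 ≤ r (t + 2)) (t : ℕ) :
    K * 2 ^ t + 8 * t ≤ Real.log (r (t + 1) / r t) := by
  have hlog : ∀ t, Real.log (r (t + 1) / r t) = Real.log (r (t + 1)) - Real.log (r t) :=
    fun t => Real.log_div (hr _).ne' (hr _).ne'
  have h0 : ∀ t, Real.log (r 0) ≤ Real.log (r t) := fun t =>
    Real.log_le_log (hr 0) (monotone_nat_of_le_succ hmono (Nat.zero_le t))
  have hstep : ∀ t : ℕ, K * 2 ^ t + 8 * t + β ≤ Real.log (r (t + 1)) - 2 * Real.log (r t) →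
      K * 2 ^ t + 8 * t ≤ Real.log (r (t + 1) / r t) := by
    intro t ht
    rw [hlog]
    linarith [h0 t]
  -- Factoring out one root 2, `log r (t+1) - 2 log r t` doubles at each step up to an error linear
  -- in `t`. The term `8t` absorbs the loss `(2⁻ᵗ)⁸`, and `β` the constants.
  have hmain : ∀ t : ℕ, K * 2 ^ t + 8 * t + β ≤ Real.log (r (t + 1)) - 2 * Real.log (r t) := by
    intro t
    induction t with
    | zero => simpa using hinit
    | succ t ih =>
      have hR := hrec t (hstep t ih)
      have hq : 0 < r (t + 1) / r t := div_pos (hr _) (hr _)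
      have h2 := Real.log_le_log (by positivity) hR
      rw [Real.log_mul (by positivity) (by positivity), Real.log_mul (by positivity) (by positivity),
        Real.log_pow, Real.log_pow, Real.log_pow, Real.log_mul hη.ne' (by positivity), Real.log_pow,
        one_div, Real.log_inv, hlog] at h2
      have hlog2 : (t : ℝ) * Real.log 2 ≤ t :=
        mul_le_of_le_one_right (Nat.cast_nonneg t) (by linarith [Real.log_two_lt_d9])
      push_cast at h2 ⊢
      rw [pow_succ]
      nlinarith
  exact hstep t (hmain t)

/-! ### Consequences of the density hypothesis, and series. -/

/-- The density hypothesis in terms of extended nonnegative reals, uniformly over all large scales. -/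
lemma exists_density_bound {S : Set ℝ} {δ : ℝ} (hδ : 0 < δ)
    (hS : (fun l : ℝ => ⨆ x : ℝ, volume.real (S ∩ Icc (x - l) (x + l)) / l)
        =O[atTop] fun l : ℝ => 1 / (Real.log (Real.log l)) ^ (1 + δ)) :
    ∃ C > (0 : ℝ), ∃ l₀ : ℝ, ∀ ρ ≥ l₀, 0 < Real.log (Real.log ρ) → ∀ l ≥ ρ, ∀ x,
      volume (S ∩ Icc (x - l) (x + l)) ≤
        ENNReal.ofReal (C / (Real.log (Real.log ρ)) ^ (1 + δ) * l) := by
  obtain ⟨C, hC, hbound⟩ := hS.exists_pos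
  rw [Asymptotics.isBigOWith_iff] at hbound
  obtain ⟨l₁, hl₁⟩ := eventually_atTop.1 hbound
  refine ⟨C, hC, max l₁ (Real.exp 1), fun ρ hρ hpos l hl x => ?_⟩
  have hρe : Real.exp 1 ≤ ρ := (le_max_right _ _).trans hρ
  have hρ0 : 0 < ρ := (Real.exp_pos 1).trans_le hρe
  have hl0 : 0 < l := hρ0.trans_le hl
  have hlogρ : 1 ≤ Real.log ρ := (Real.le_log_iff_exp_le hρ0).2 hρe
  have hloglog : Real.log (Real.log ρ) ≤ Real.log (Real.log l) :=
    Real.log_le_log (by linarith) (Real.log_le_log hρ0 hl)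
  have hfin : ∀ x, volume (S ∩ Icc (x - l) (x + l)) ≠ ⊤ := fun x =>
    measure_ne_top_of_subset inter_subset_right measure_Icc_lt_top.ne
  -- Needed because a real supremum defaults to 0 on an unbounded family.
  have hbdd : BddAbove (range fun x : ℝ => volume.real (S ∩ Icc (x - l) (x + l)) / l) := by
    refine ⟨2, ?_⟩
    rintro _ ⟨x, rfl⟩
    refine (div_le_iff₀ hl0).2 ?_
    calc volume.real (S ∩ Icc (x - l) (x + l)) ≤ volume.real (Icc (x - l) (x + l)) :=
          measureReal_mono inter_subset_right measure_Icc_lt_top.ne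
      _ = 2 * l := by
          rw [Real.volume_real_Icc_of_le (by linarith)]
          ring
  have h1 := hl₁ l ((le_max_left _ _).trans (hρ.trans hl))
  have h2 : volume.real (S ∩ Icc (x - l) (x + l)) / l ≤
      C * (1 / (Real.log (Real.log l)) ^ (1 + δ)) := by
    refine (le_ciSup hbdd x).trans ((le_abs_self _).trans (h1.trans_eq ?_))
    rw [Real.norm_eq_abs, abs_of_nonneg]
    exact one_div_nonneg.2 (Real.rpow_nonneg (hpos.le.trans hloglog) _)
  rw [← ofReal_measureReal (hfin x)]
  refine ENNReal.ofReal_le_ofReal ?_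
  rw [← div_le_iff₀ hl0]
  refine h2.trans ?_
  rw [mul_one_div]
  gcongr

/-- A set of vanishing density misses arbitrarily large points. -/
lemma exists_ge_notMem_of_density {S : Set ℝ} {δ C l₀ : ℝ} (hδ : 0 < δ)
    (hdens : ∀ ρ ≥ l₀, 0 < Real.log (Real.log ρ) → ∀ l ≥ ρ, ∀ x,
      volume (S ∩ Icc (x - l) (x + l)) ≤
        ENNReal.ofReal (C / (Real.log (Real.log ρ)) ^ (1 + δ) * l)) (M : ℝ) :
    ∃ x ≥ M, x ∉ S := by
  by_contra! hcon
  have hll : Tendsto (fun l => Real.log (Real.log l)) atTop atTop :=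
    Real.tendsto_log_atTop.comp Real.tendsto_log_atTop
  have hpow := (tendsto_rpow_atTop (show 0 < 1 + δ by linarith)).comp hll
  obtain ⟨l, hl, hpos, hl0, hC⟩ := ((eventually_ge_atTop l₀).and
    ((hll.eventually_gt_atTop 0).and ((eventually_gt_atTop 0).and
      (hpow.eventually_ge_atTop C)))).exists
  have hC' : C ≤ Real.log (Real.log l) ^ (1 + δ) := hC
  have h := hdens l hl hpos l le_rfl (M + l)
  have hsub : Icc (M + l - l) (M + l + l) ⊆ S := fun x hx => hcon x (by linarith [hx.1])
  rw [inter_eq_right.2 hsub, Real.volume_Icc] at h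
  have hq : C / Real.log (Real.log l) ^ (1 + δ) * l ≤ l :=
    mul_le_of_le_one_left hl0.le (div_le_one_of_le₀ hC' (Real.rpow_nonneg hpos.le _))
  rw [ENNReal.ofReal_le_ofReal_iff'] at h
  rcases h with h | h <;> linarith

lemma exists_tsum_shift_rpow_le {δ : ℝ} (hδ : 0 < δ) (C : ℝ) {ε : ℝ} (hε : 0 < ε) (M : ℝ) :
    ∃ N : ℕ, M ≤ N ∧ Summable (fun t : ℕ => C / ((t : ℝ) + N) ^ (1 + δ)) ∧
      ∑' t : ℕ, C / ((t : ℝ) + N) ^ (1 + δ) ≤ ε := by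
  have hs : Summable fun n : ℕ => C / (n : ℝ) ^ (1 + δ) := by
    have := (Real.summable_one_div_nat_rpow.2 (show 1 < 1 + δ by linarith)).mul_left C
    simpa only [mul_one_div] using this
  have ht := tendsto_sum_nat_add fun n : ℕ => C / (n : ℝ) ^ (1 + δ)
  obtain ⟨N, hN, hNM⟩ := ((ht.eventually_le_const hε).and
    (tendsto_natCast_atTop_atTop.eventually_ge_atTop M)).exists
  refine ⟨N, hNM, ?_, ?_⟩
  · simpa using (summable_nat_add_iff N).2 hs
  · simpa using hN

lemma limsup_average_eq_top_of_sq_ge {v : ℕ → ℝ} {κ : ℝ} (hκ : 0 < κ)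
    (hv : ∀ t : ℕ, κ * ((t : ℝ) + 1) ^ 2 ≤ v (t + 1) ^ 2) :
    limsup (fun t : ℕ => (((1 / (t : ℝ)) * ∑ i ∈ Finset.Icc 1 t, (v i) ^ 2 : ℝ) : EReal)) atTop
      = ⊤ := by
  refine Tendsto.limsup_eq ?_
  rw [EReal.tendsto_coe_nhds_top_iff]
  refine tendsto_atTop_mono' atTop ?_
    (tendsto_natCast_atTop_atTop (R := ℝ).const_mul_atTop hκ)
  filter_upwards [eventually_ge_atTop 1] with t ht
  obtain ⟨s, rfl⟩ := Nat.exists_eq_add_of_le' ht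
  have h1 : v (s + 1) ^ 2 ≤ ∑ i ∈ Finset.Icc 1 (s + 1), v i ^ 2 :=
    Finset.single_le_sum (f := fun i => v i ^ 2) (fun i _ => sq_nonneg _) (by simp)
  have hs : (0 : ℝ) < s + 1 := by positivity
  push_cast
  rw [one_div, ← div_eq_inv_mul, le_div_iff₀ hs]
  have := hv s
  nlinarith

/-- Explains the choice `K = 2 exp N`: the factor 2 pays for the square root, and `log (exp N * 2ᵗ)
= N + t log 2`. -/
lemma sqrt_ge_and_loglog_sqrt_ge {q : ℝ} (hq : 0 < q) {N t : ℕ}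
    (h : 2 * Real.exp N * 2 ^ t + 8 * t ≤ Real.log q) :
    (N : ℝ) ≤ √q ∧ ((t : ℝ) + N) / 2 ≤ Real.log (Real.log √q) := by
  have hlog : Real.exp N * 2 ^ t ≤ Real.log √q := by
    rw [Real.log_sqrt hq.le]
    have : (0 : ℝ) ≤ t := Nat.cast_nonneg t
    linarith
  constructor
  · have h1 : (1 : ℝ) ≤ 2 ^ t := one_le_pow₀ (by norm_num)
    have h2 : (N : ℝ) ≤ Real.exp N * 2 ^ t := by
      nlinarith [Real.add_one_le_exp (N : ℝ), Real.exp_pos (N : ℝ)]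
    calc (N : ℝ) ≤ Real.log √q := h2.trans hlog
      _ ≤ √q := Real.log_le_self (Real.sqrt_nonneg q)
  · have h1 := Real.log_le_log (by positivity) hlog
    rw [Real.log_mul (by positivity) (by positivity), Real.log_exp, Real.log_pow] at h1
    have h2 : (t : ℝ) * (1 / 2) ≤ t * Real.log 2 :=
      mul_le_mul_of_nonneg_left (by linarith [Real.log_two_gt_d9]) (Nat.cast_nonneg t)
    have h3 : (0 : ℝ) ≤ N := Nat.cast_nonneg N
    linarith

/-! ### The main theorem. -/

theorem theorem2p3 {Ω : Type*} [MeasurableSpace Ω] (P : Measure Ω) [IsProbabilityMeasure P]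
    (f : ℝ → ℝ) (hf : PiecewiseContinuous f)
    -- the noise `w 1, w 2, …` is i.i.d. standard normal
    (w : ℕ → Ω → ℝ) (hw_meas : ∀ t : ℕ, Measurable (w (t + 1)))
    (hw_law : ∀ t : ℕ, P.map (w (t + 1)) = gaussianReal 0 1)
    (hw_indep : iIndepFun (fun t : ℕ => w (t + 1)) P)
    -- the parameter is normal with mean `θ₀` and variance `P₀`, and independent of the noise
    (θ : Ω → ℝ) (θ₀ : ℝ) (P₀ : ℝ≥0) (hP₀ : 0 < P₀) (hθ_meas : Measurable θ)
    (hθ_law : P.map θ = gaussianReal θ₀ P₀)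
    (hθ_indep : IndepFun θ (fun ω (t : ℕ) => w (t + 1) ω) P)
    (hS : ∃ δ > (0 : ℝ), ∃ L > (0 : ℝ),
      (fun l : ℝ => ⨆ x : ℝ, volume.real (slowSet f L ∩ Icc (x - l) (x + l)) / l)
        =O[atTop] fun l : ℝ => 1 / (Real.log (Real.log l)) ^ (1 + δ)) :
    Unstabilizable P f θ w := by
  obtain ⟨δ, hδ, L, hL, hO⟩ := hS
  have hfm := hf.measurable
  have hSm := measurableSet_slowSet hfm L
  obtain ⟨C, hC, l₀, hdens⟩ := exists_density_bound hδ hO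
  obtain ⟨G, hG, hgauss⟩ := exists_gaussianReal_preimage_le
  obtain ⟨N, hN, hNsum, hNle⟩ := exists_tsum_shift_rpow_le hδ (G * C * 2 ^ (1 + δ))
    (ε := 1 / 4) (by norm_num) (max 1 l₀)
  have hN1 : (1 : ℝ) ≤ N := (le_max_left _ _).trans hN
  have hNl : l₀ ≤ N := (le_max_right _ _).trans hN
  -- The small-ball terms `2 η 2⁻ᵗ` then sum to 1/4, as much as is allowed for the slow set.
  set η : ℝ := 1 / 16 with hη
  set K : ℝ := 2 * Real.exp N with hK
  set β : ℝ := max (8 - 2 * Real.log L - 8 * Real.log η) (-Real.log (1 / P₀)) with hβ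
  set M : ℝ := Real.exp (K + β + 2 * Real.log (1 / P₀)) with hM
  -- Chosen before the control law: one initial value defeats all laws.
  obtain ⟨x₀, hx₀, hx₀S⟩ := exists_ge_notMem_of_density hδ hdens (max 1 ((M + 1) / L))
  have hx1 : 1 ≤ x₀ := (le_max_left _ _).trans hx₀
  have hfx : M ≤ f x₀ ^ 2 := by
    have h1 : L * |x₀| ^ 4 ≤ |f x₀| := not_lt.1 hx₀S
    have h2 : M + 1 ≤ L * x₀ := by
      have := (le_max_right _ _).trans hx₀
      rwa [div_le_iff₀' hL] at this
    have h3 : x₀ ≤ |x₀| ^ 4 := (le_abs_self x₀).trans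
      (le_self_pow₀ (hx1.trans (le_abs_self x₀)) (by norm_num))
    have h4 : M + 1 ≤ |f x₀| := h2.trans ((mul_le_mul_of_nonneg_left h3 hL.le).trans h1)
    rw [← sq_abs]
    nlinarith [Real.exp_pos (K + β + 2 * Real.log (1 / P₀))]
  intro u y hcl
  replace hcl := hcl x₀
  generalize u x₀ = u at hcl
  refine ⟨x₀, ?_⟩
  generalize y x₀ = y at hcl
  have hy : ∀ i, Measurable (y i) := fun i =>
    hcl.measurable_output hfm hθ_meas (fun j _ => hw_meas j) i le_rfl
  let q : ℕ → (ℕ → ℝ) → ℝ := fun t h => precision f P₀ (t + 1) h / precision f P₀ t h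
  have hqpos : ∀ t h, 0 < q t h := fun t h => div_pos (precision_pos hP₀ _ _) (precision_pos hP₀ _ _)
  have hqm : ∀ t, Measurable (q t) := fun t =>
    (measurable_precision hfm _).div (measurable_precision hfm _)
  -- fast growth so far, followed by a slow or a small output
  let E : ℕ → Set ((ℕ → ℝ) × ℝ) := fun t => {v | K * 2 ^ t + 8 * t ≤ Real.log (q t v.1) ∧
    (v.2 ∈ slowSet f L ∨ |v.2| < η * (1 / 2) ^ t * √(q t v.1))}
  have hEm : ∀ t, MeasurableSet (E t) := by
    intro t
    refine MeasurableSet.inter ?_ (MeasurableSet.union (measurable_snd hSm) ?_)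
    · exact measurableSet_le measurable_const ((hqm t).comp measurable_fst).log
    · exact measurableSet_lt (by fun_prop)
        (measurable_const.mul ((hqm t).comp measurable_fst).sqrt)
  let p : ℕ → ℝ := fun t =>
    G * C * 2 ^ (1 + δ) / ((t : ℝ) + N) ^ (1 + δ) + 2 * (η * (1 / 2) ^ t)
  have hE : ∀ t, P {ω | (history y t ω, y (t + 1) ω) ∈ E t} ≤ ENNReal.ofReal (p t) := by
    intro t
    obtain ⟨c, -, hpred⟩ := hcl.predictive hfm hθ_meas hw_meas hw_law hw_indep hθ_indep hP₀ hθ_law t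
    refine measure_bad_le (c := c) (σ := fun h => √(q t h)) hpred
      (measurable_history fun i _ => hy i) (hy (t + 1)) (hEm t) fun h => ?_
    by_cases hh : K * 2 ^ t + 8 * t ≤ Real.log (q t h)
    · obtain ⟨hρN, hll⟩ := sqrt_ge_and_loglog_sqrt_ge (hqpos t h) hh
      have hρ : 0 < √(q t h) := Real.sqrt_pos.2 (hqpos t h)
      have htN : (0 : ℝ) < ((t : ℝ) + N) / 2 := by positivity
      have hllpos : 0 < Real.log (Real.log √(q t h)) := htN.trans_le hll
      calc _ ≤ gaussianReal 0 1 ({n | c h + √(q t h) * n ∈ slowSet f L} ∪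
            {n | |c h + √(q t h) * n| < η * (1 / 2) ^ t * √(q t h)}) :=
            measure_mono fun n hn => hn.2
        _ ≤ _ + _ := measure_union_le _ _
        _ ≤ ENNReal.ofReal (G * C * 2 ^ (1 + δ) / ((t : ℝ) + N) ^ (1 + δ)) +
            ENNReal.ofReal (2 * (η * (1 / 2) ^ t)) := by
            refine add_le_add ?_ (gaussianReal_small_ball_le _ hρ _)
            refine (hgauss _ hSm _ _ (C / Real.log (Real.log √(q t h)) ^ (1 + δ)) hρ
              (by positivity) (hdens _ (hNl.trans hρN) hllpos)).trans ?_
            refine ENNReal.ofReal_le_ofReal ?_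
            calc G * (C / Real.log (Real.log √(q t h)) ^ (1 + δ))
                ≤ G * (C / (((t : ℝ) + N) / 2) ^ (1 + δ)) := by gcongr
              _ = _ := by
                rw [Real.div_rpow (by positivity) (by norm_num)]
                field_simp
        _ = ENNReal.ofReal (p t) := (ENNReal.ofReal_add (by positivity) (by positivity)).symm
    -- Growth is built into `E t`, so histories without it cost nothing and the bound needs no
    -- conditioning on earlier good events.
    · have : {n : ℝ | (h, c h + √(q t h) * n) ∈ E t} = ∅ :=
        eq_empty_of_forall_notMem fun n hn => hh hn.1
      rw [this, measure_empty]
      exact zero_le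
  let B : Set Ω := ⋃ t, {ω | (history y t ω, y (t + 1) ω) ∈ E t}
  have hBm : MeasurableSet B := MeasurableSet.iUnion fun t =>
    ((measurable_history fun i _ => hy i).prodMk (hy (t + 1))) (hEm t)
  have hgeom : Summable fun t : ℕ => 2 * (η * (1 / 2 : ℝ) ^ t) :=
    (summable_geometric_two.mul_left η).mul_left 2
  have hBlt : P B < 1 := by
    calc P B ≤ ∑' t, ENNReal.ofReal (p t) := (measure_iUnion_le _).trans (ENNReal.tsum_le_tsum hE)
      _ = ENNReal.ofReal (∑' t, p t) :=
          (ENNReal.ofReal_tsum_of_nonneg (fun t => by positivity) (hNsum.add hgeom)).symm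
      _ ≤ ENNReal.ofReal (1 / 2) := by
          refine ENNReal.ofReal_le_ofReal ?_
          rw [hNsum.tsum_add hgeom, tsum_mul_left, tsum_mul_left, tsum_geometric_two]
          linarith
      _ < 1 := by
          rw [← ENNReal.ofReal_one]
          exact (ENNReal.ofReal_lt_ofReal_iff one_pos).2 (by norm_num)
  refine ⟨Bᶜ, hBm.compl, ?_, fun ω hω => ?_⟩
  · rw [prob_compl_eq_one_sub hBm]
    exact tsub_pos_of_lt hBlt
  -- along a path that avoids all bad events
  let r : ℕ → ℝ := fun t => precision f P₀ t fun i => y i ω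
  have hrpos : ∀ t, 0 < r t := fun t => precision_pos hP₀ _ _
  have hrsucc : ∀ t, r (t + 1) = r t + f (y t ω) ^ 2 := fun t => precision_succ _ _
  have hqr : ∀ t, q t (history y t ω) = r (t + 1) / r t := by
    intro t
    have h1 : precision f P₀ (t + 1) (history y t ω) = r (t + 1) :=
      precision_congr fun i hi => history_of_le (Nat.lt_succ_iff.1 hi) ω
    have h2 : precision f P₀ t (history y t ω) = r t :=
      precision_congr fun i hi => history_of_le hi.le ω
    simp only [q, h1, h2]
  have hgood : ∀ t : ℕ, K * 2 ^ t + 8 * t ≤ Real.log (r (t + 1) / r t) →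
      y (t + 1) ω ∉ slowSet f L ∧ η * (1 / 2) ^ t * √(r (t + 1) / r t) ≤ |y (t + 1) ω| := by
    intro t ht
    have h : ¬ (_ ∧ _) := fun h => hω (mem_iUnion.2 ⟨t, h⟩)
    simp only [hqr] at h
    have h' := fun hn => h ⟨ht, hn⟩
    exact ⟨fun hs => h' (Or.inl hs), not_lt.1 fun hs => h' (Or.inr hs)⟩
  have hr0 : r 0 = 1 / P₀ := by simp [r, precision]
  have hgrowth := log_ratio_ge_of_recursion (K := K) (β := β) hrpos
    (fun t => by rw [hrsucc]; linarith [sq_nonneg (f (y t ω))]) hL (show 0 < η by norm_num)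
    (le_max_left _ _) (by rw [hr0]; exact le_max_right _ _) (by
      rw [hr0]
      have h1 : M ≤ r 1 := by
        rw [hrsucc, hcl.init]
        linarith [hrpos 0]
      have h2 := Real.log_le_log (Real.exp_pos _) h1
      rw [Real.log_exp] at h2
      linarith) (by
      intro t ht
      obtain ⟨hs, hb⟩ := hgood t ht
      have hs' : L * |y (t + 1) ω| ^ 4 ≤ |f (y (t + 1) ω)| := not_lt.1 hs
      have hq : 0 < r (t + 1) / r t := div_pos (hrpos _) (hrpos _)
      calc L ^ 2 * (η * (1 / 2) ^ t) ^ 8 * (r (t + 1) / r t) ^ 4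
          = (L * (η * (1 / 2) ^ t * √(r (t + 1) / r t)) ^ 4) ^ 2 := by
            nth_rewrite 1 [← Real.sq_sqrt hq.le]
            ring
        _ ≤ (L * |y (t + 1) ω| ^ 4) ^ 2 := by gcongr
        _ ≤ |f (y (t + 1) ω)| ^ 2 := by gcongr
        _ ≤ r (t + 2) := by
            rw [sq_abs, hrsucc (t + 1)]
            linarith [hrpos (t + 1)])
  refine limsup_average_eq_top_of_sq_ge (κ := η ^ 2) (by positivity) fun t => ?_
  have hb := (hgood t (hgrowth t)).2
  have hq : 0 < r (t + 1) / r t := div_pos (hrpos _) (hrpos _)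
  -- The term `8t` is used again: `exp (8t)` outweighs the factor `4⁻ᵗ` and still leaves `(t+1)²`.
  have hexp : Real.exp t ^ 8 ≤ r (t + 1) / r t := by
    rw [← Real.exp_nat_mul, ← Real.le_log_iff_exp_le hq]
    have : 0 ≤ K * 2 ^ t := by positivity
    push_cast
    linarith [hgrowth t]
  have h1 : (t : ℝ) + 1 ≤ Real.exp t := Real.add_one_le_exp _
  have h2 : (2 : ℝ) ^ t ≤ Real.exp t := by
    rw [← Real.exp_one_pow]
    exact pow_le_pow_left₀ (by norm_num) (by linarith [Real.exp_one_gt_d9]) t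
  have h3 : 1 ≤ Real.exp (t : ℝ) := Real.one_le_exp (Nat.cast_nonneg t)
  calc η ^ 2 * ((t : ℝ) + 1) ^ 2
      ≤ η ^ 2 * ((1 / 2) ^ t * (Real.exp t) ^ 4) ^ 2 := by
        have h4 : (1 / 2 : ℝ) ^ t * 2 ^ t = 1 := by rw [← mul_pow]; norm_num
        have h5 : (t : ℝ) + 1 ≤ (1 / 2) ^ t * (Real.exp t) ^ 4 := by
          calc (t : ℝ) + 1 ≤ Real.exp t ^ 3 := h1.trans (le_self_pow₀ h3 (by norm_num))
            _ = ((1 / 2 : ℝ) ^ t * 2 ^ t) * Real.exp t ^ 3 := by rw [h4, one_mul]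
            _ ≤ ((1 / 2 : ℝ) ^ t * Real.exp t) * Real.exp t ^ 3 := by gcongr
            _ = _ := by ring
        gcongr
    _ = (η * (1 / 2) ^ t) ^ 2 * Real.exp t ^ 8 := by ring
    _ ≤ (η * (1 / 2) ^ t) ^ 2 * (r (t + 1) / r t) := by gcongr
    _ = (η * (1 / 2) ^ t * √(r (t + 1) / r t)) ^ 2 := by
        rw [mul_pow _ (√_), Real.sq_sqrt hq.le]
    _ ≤ |y (t + 1) ω| ^ 2 := by gcongr
    _ = y (t + 1) ω ^ 2 := sq_abs _
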